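/- Let $Sym=\mathbb{Q}[p_1,p_2,p_3,\dots]$ be the ring of symmetric functions. For a partition $\lambda$ with $m_i$ parts equal to $i$ put $z_\lambda=\prod_i m_i!\,i^{m_i}$, $p_\lambda=\prod_i p_{\lambda_i}$, $h_n=\sum_{\lambda\vdash n}p_\lambda/z_\lambda$ and $h_\lambda=\prod_i h_{\lambda_i}$. The Kronecker product $\ast$ is the bilinear product on $Sym$ with $\frac{p_\lambda}{z_\lambda}\ast\frac{p_\mu}{z_\mu}=\delta_{\lambda=\mu}\frac{p_\lambda}{z_\lambda}$. A multiset partition $\pi$ of a finite multiset $S$ is a finite multiset of nonempty multisets whose union, counted with multiplicities, is $S$. Its length $\ell(\pi)$ is the number of these multisets, counted with multiplicity, and $\tilde m(\pi)$ is the partition of $\ell(\pi)$ whose parts are the multiplicities with which the distinct multisets occur in $\pi$. The induced trivial character basis $\{\tilde h_\lambda\}$ of $Sym$ is defined recursively by $$\tilde h_\lambda = h_\lambda-\sum_{\pi}\tilde h_{\tilde m(\pi)},$$ where the sum is over the multiset partitions $\pi$ of the multiset $\{1^{\lambda_1},2^{\lambda_2},\dots,\ell^{\lambda_\ell}\}$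 with $\tilde m(\pi)\ne\lambda$ (such $\pi$ have $\ell(\pi)<|\lambda|$). For a multiset partition $\theta$ and a multiset $T$, the restriction $\theta|_T$ is obtained by deleting from each multiset of $\theta$ all elements that do not belong to $T$, and then throwing away the empty multisets. Let $\pi$ be a multiset partition of $S$ and $\tau$ a multiset partition of $T$, where the multisets $S$ and $T$ are disjoint (no element belongs to both). Let $\pi\#\tau$ be the set of all multiset partitions $\theta$ of $S\cup T$ such that $\theta|_S=\pi$ and $\theta|_T=\tau$. Then $$\tilde h_{\tilde m(\pi)}\,\tilde h_{\tilde m(\tau)}=\sum_{\theta\in\pi\#\tau}\tilde h_{\tilde m(\theta)}.$$ Moreover, for every integer $n\ge \ell(\pi)+\ell(\tau)$, $$\bigl(h_{n-\ell(\pi)}h_{\tilde m(\pi)}\bigr)\ast\bigl(h_{n-\ell(\tau)}h_{\tilde m(\tau)}\bigr)=\sum_{\theta\in\pi\#\tau}h_{n-\ell(\theta)}h_{\tilde m(\theta)}.$$ -/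

import Mathlib

namespace CharBasis

open Finset

/-! ### The ring of symmetric functions -/

/-- The ring of symmetric functions `Sym = ℚ[p₁, p₂, p₃, …]`, a polynomial ring in the power sums.
The variable `X i` (`i : ℕ`) stands for the power sum `p_{i+1}`. -/
abbrev SymFun : Type := MvPolynomial ℕ ℚ

/-- The power sum `p_k`, for `k ≥ 1` (the value at `k = 0` is never used). -/
noncomputable def pSym (k : ℕ) : SymFun := MvPolynomial.X (k - 1)

/-- `z_λ = ∏ᵢ mᵢ! i ^ mᵢ`, where `mᵢ` is the multiplicity of `i` among the parts `s` of `λ`. -/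
def zee (s : Multiset ℕ) : ℕ := ∏ i ∈ s.toFinset, (s.count i).factorial * i ^ s.count i

/-- The power sum basis element `p_λ`. -/
noncomputable def pPart {n : ℕ} (lam : n.Partition) : SymFun := (lam.parts.map pSym).prod

/-- The complete symmetric function `h_n = ∑_{λ ⊢ n} p_λ / z_λ`. -/
noncomputable def hSym (n : ℕ) : SymFun :=
  ∑ lam : n.Partition, ((zee lam.parts : ℚ)⁻¹) • pPart lam

/-- The complete basis element `h_λ = h_{λ₁} h_{λ₂} ⋯`. -/
noncomputable def hPart {n : ℕ} (lam : n.Partition) : SymFun := (lam.parts.map hSym).prod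

/-- The Kronecker product: the bilinear product on `Sym` with
`(p_λ / z_λ) ∗ (p_μ / z_μ) = δ_{λ = μ} p_λ / z_λ`, i.e. `p_λ ∗ p_λ = z_λ p_λ` and
`p_λ ∗ p_μ = 0` for `λ ≠ μ`.  The exponent vector `e` is that of the monomial `p_λ` where `i + 1`
has multiplicity `e i` in `λ`. -/
noncomputable def kronecker (f g : SymFun) : SymFun :=
  ∑ e ∈ f.support, MvPolynomial.monomial e
    (f.coeff e * g.coeff e * (zee ((Finsupp.toMultiset e).map (· + 1)) : ℚ))

/-! ### Multiset partitions -/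

section MultisetPartitions

variable {α : Type*}

/-- `π` is a multiset partition of the multiset `S`: a multiset of nonempty multisets whose
sum (union with multiplicities) is `S`. -/
def IsMultisetPartition (π : Multiset (Multiset α)) (S : Multiset α) : Prop :=
  0 ∉ π ∧ π.sum = S

theorem card_le_card_sum (π : Multiset (Multiset α)) (h0 : 0 ∉ π) :
    Multiset.card π ≤ Multiset.card π.sum := by
  induction π using Multiset.induction_on with
  | empty => simp
  | cons A π ih =>
    simp only [Multiset.mem_cons, not_or] at h0
    have hA : 0 < Multiset.card A := Multiset.card_pos.2 (fun e => h0.1 e.symm)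
    have := ih h0.2
    simp only [Multiset.card_cons, Multiset.sum_cons, Multiset.card_add]
    omega

theorem finite_multisetPartition (S : Multiset α) :
    {π : Multiset (Multiset α) | IsMultisetPartition π S}.Finite := by
  classical
  refine (Multiset.finite_toSet
    (Multiset.powerset (Multiset.card S • Multiset.powerset S))).subset ?_
  rintro π ⟨h0, rfl⟩
  simp only [Set.mem_ofPred_eq, Multiset.mem_powerset]
  rw [Multiset.le_iff_count]
  intro A
  by_cases hA : A ∈ π
  · have h1 : 1 ≤ Multiset.count A (Multiset.powerset π.sum) := by
      rw [Multiset.one_le_count_iff_mem, Multiset.mem_powerset]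
      exact Multiset.le_sum_of_mem hA
    rw [Multiset.count_nsmul]
    calc Multiset.count A π ≤ Multiset.card π := Multiset.count_le_card _ _
      _ ≤ Multiset.card π.sum := card_le_card_sum π h0
      _ ≤ _ := Nat.le_mul_of_pos_right _ h1
  · simp [Multiset.count_eq_zero_of_notMem hA]

/-- The finite set of all multiset partitions of `S`. -/
noncomputable def multisetPartitions (S : Multiset α) : Finset (Multiset (Multiset α)) :=
  (finite_multisetPartition S).toFinset

theorem mem_multisetPartitions {S : Multiset α} {π : Multiset (Multiset α)} :
    π ∈ multisetPartitions S ↔ IsMultisetPartition π S := by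
  simp [multisetPartitions]

variable [DecidableEq α]

/-- `m̃(π)`: the partition of `ℓ(π)` given by the multiplicities of the multisets occurring
in `π`. -/
def mTilde (π : Multiset (Multiset α)) : (Multiset.card π).Partition where
  parts := π.toFinset.val.map (fun A => π.count A)
  parts_pos := by
    intro i hi
    obtain ⟨A, hA, rfl⟩ := Multiset.mem_map.1 hi
    exact Multiset.count_pos.2 (Multiset.mem_toFinset.1 hA)
  parts_sum := Multiset.toFinset_sum_count_eq π

/-- The restriction `π|_T = {{ A|_T : A ∈ π }}` of a multiset partition to the elements of `T`,
with empty multisets thrown away; here `A|_T = {{ v ∈ A : v ∈ T }}`. -/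
def restrict (π : Multiset (Multiset α)) (T : Multiset α) : Multiset (Multiset α) :=
  (π.map (fun A => A.filter (· ∈ T))).filter (· ≠ 0)

/-- `π # τ`, for multiset partitions `π` of `S` and `τ` of `T`: the set of the multiset partitions
`θ` of `S ∪ T` (which is `S + T` for disjoint `S` and `T`) with `θ|_S = π` and `θ|_T = τ`. -/
noncomputable def sharp (S T : Multiset α) (π τ : Multiset (Multiset α)) :
    Finset (Multiset (Multiset α)) :=
  (multisetPartitions (S + T)).filter (fun θ => restrict θ S = π ∧ restrict θ T = τ)

end MultisetPartitions

/-! ### The induced trivial character basis -/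

/-- The multiset `{{1^{λ₁}, 2^{λ₂}, …, ℓ^{λ_ℓ}}}`, where `λ₁ ≥ λ₂ ≥ ⋯ ≥ λ_ℓ` are the parts
of `λ`. -/
def content {n : ℕ} (lam : n.Partition) : Multiset ℕ :=
  ∑ i : Fin (lam.parts.sort (· ≥ ·)).length,
    Multiset.replicate ((lam.parts.sort (· ≥ ·)).get i) (i.1 + 1)

theorem eq_map_singleton {α : Type*} (π : Multiset (Multiset α)) (h0 : 0 ∉ π)
    (hc : Multiset.card π.sum ≤ Multiset.card π) : π = π.sum.map (fun a => {a}) := by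
  induction π using Multiset.induction_on with
  | empty => simp
  | cons A π ih =>
    simp only [Multiset.mem_cons, not_or] at h0
    have hA : 0 < Multiset.card A := Multiset.card_pos.2 (fun e => h0.1 e.symm)
    have h1 := card_le_card_sum π h0.2
    simp only [Multiset.card_cons, Multiset.sum_cons, Multiset.card_add] at hc
    obtain ⟨a, rfl⟩ := Multiset.card_eq_one.1 (show Multiset.card A = 1 by omega)
    have h2 := ih h0.2 (by simp at hc; omega)
    rw [Multiset.sum_cons, Multiset.singleton_add, Multiset.map_cons, ← h2]

theorem count_content {n : ℕ} (lam : n.Partition) (i : Fin (lam.parts.sort (· ≥ ·)).length) :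
    (content lam).count (i.1 + 1) = (lam.parts.sort (· ≥ ·)).get i := by
  unfold content
  rw [Multiset.count_sum', Finset.sum_eq_single i]
  · simp
  · intro j _ hj
    rw [Multiset.count_replicate, if_neg]
    intro e
    exact hj (Fin.ext (by omega))
  · simp

theorem card_content {n : ℕ} (lam : n.Partition) : Multiset.card (content lam) = n := by
  unfold content
  rw [Multiset.card_sum]
  simp only [Multiset.card_replicate]
  rw [← List.sum_ofFn, List.ofFn_get, ← Multiset.sum_coe, Multiset.sort_eq, lam.parts_sum]

theorem toFinset_content {n : ℕ} (lam : n.Partition) :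
    (content lam).toFinset = Finset.univ.image
      (fun i : Fin (lam.parts.sort (· ≥ ·)).length => i.1 + 1) := by
  ext a
  simp only [Multiset.mem_toFinset, Finset.mem_image, Finset.mem_univ, true_and]
  constructor
  · intro ha
    unfold content at ha
    obtain ⟨i, _, hi⟩ := Multiset.mem_sum.1 ha
    exact ⟨i, (Multiset.eq_of_mem_replicate hi).symm⟩
  · rintro ⟨i, rfl⟩
    rw [← Multiset.count_pos, count_content]
    apply lam.parts_pos
    rw [← Multiset.mem_sort (r := (· ≥ ·))]
    exact List.get_mem _ _

theorem map_count_content {n : ℕ} (lam : n.Partition) :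
    (content lam).toFinset.val.map (fun a => (content lam).count a) = lam.parts := by
  rw [toFinset_content, Finset.image_val_of_injOn
    (fun i _ j _ e => Fin.ext (by simpa using e)), Multiset.map_map]
  simp only [Function.comp_def, count_content]
  rw [Fin.univ_val_map, List.ofFn_get, Multiset.sort_eq]

theorem card_lt_of_mTilde_ne {n : ℕ} (lam : n.Partition) {π : Multiset (Multiset ℕ)}
    (hπ : IsMultisetPartition π (content lam)) (hne : (mTilde π).parts ≠ lam.parts) :
    Multiset.card π < n := by
  obtain ⟨h0, hs⟩ := hπ
  by_contra hlt
  apply hne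
  have hinj : Function.Injective (fun a : ℕ => ({a} : Multiset ℕ)) :=
    fun a b e => Multiset.singleton_inj.1 e
  have h1 := eq_map_singleton π h0 (by rw [hs, card_content]; omega)
  rw [hs] at h1
  rw [← map_count_content lam, h1]
  simp only [mTilde]
  rw [Multiset.toFinset_map, Finset.image_val_of_injOn hinj.injOn, Multiset.map_map]
  simp only [Function.comp_def, Multiset.count_map_eq_count' _ _ hinj]

/-- The induced trivial character basis `h̃_λ`, defined by the recursion
`h̃_λ = h_λ - ∑ h̃_{m̃(π)}`, the sum over the multiset partitions `π` of
`{{1^{λ₁}, …, ℓ^{λ_ℓ}}}` with `m̃(π) ≠ λ`. -/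
noncomputable def hTilde {n : ℕ} (lam : n.Partition) : SymFun :=
  hPart lam - ∑ π ∈ ((multisetPartitions (content lam)).filter
    (fun π => (mTilde π).parts ≠ lam.parts)).attach, hTilde (mTilde π.1)
termination_by n
decreasing_by
  have hπ := Finset.mem_filter.1 π.2
  exact card_lt_of_mTilde_ne lam (mem_multisetPartitions.1 hπ.1) hπ.2

end CharBasis

open CharBasis

namespace CharBasis

open Finset MvPolynomial

/-! ### The expansion of `h_n` in power sums -/

/-! Both identities express a single bijection, seen through two families of functionals. Consider a
permutation with cycles `c` of lengths `m c + 1`, and label every cycle by a multiset, possibly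
empty. Recording each nonempty label with the length of its cycle gives a multiset partition
`labelType m F`; let L(π) be the number of labellings of type π. For disjoint S and T, labellings F
of type π and G of type τ merge into F + G, whose type lies in π # τ. Filtering the labels by S and
by T undoes this, so L(π) L(τ) = ∑ L(θ) over θ in π # τ (`card_labellings_mul`).

For the ordinary product, `evalCycles m` is a ring homomorphism. It sends h_λ to the number of
labellings with total content {{1^λ₁, 2^λ₂, …}}. Sorting these by type turns the recursion for h̃
into the statement that h̃ of m̃(π) evaluates to L(π) (`evalCycles_hTilde_mTilde`). These
evaluations separate symmetric functions (`ext_evalCycles`).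

For the Kronecker product, `charValue m` is z times a coefficient, hence multiplicative for ∗. It
sends h_{n-ℓ(π)} h_{m̃(π)} to L(π) when the cycles have total length n, and to 0 otherwise
(`charValue_hSym_mul_hPart`). These values determine all coefficients (`ext_charValue`). -/

/-- The size of the partition in which `i + 1` has multiplicity `e i`. -/
def expWeight (e : ℕ →₀ ℕ) : ℕ := e.sum fun i a => a * (i + 1)

/-- The centralizer order `z` of the partition in which `i + 1` has multiplicity `e i`. -/
def expZee (e : ℕ →₀ ℕ) : ℕ := e.prod fun i a => a.factorial * (i + 1) ^ a

theorem zee_map_succ (e : ℕ →₀ ℕ) :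
    zee ((Finsupp.toMultiset e).map (· + 1)) = expZee e := by
  have hinj : Function.Injective (fun i : ℕ => i + 1) := fun _ _ h => Nat.succ_injective h
  unfold zee expZee Finsupp.prod
  rw [Multiset.toFinset_map, Finset.prod_image hinj.injOn, Finsupp.toFinset_toMultiset]
  refine Finset.prod_congr rfl fun i _ => ?_
  rw [Multiset.count_map_eq_count' _ _ hinj, Finsupp.count_toMultiset]

theorem expZee_pos (e : ℕ →₀ ℕ) : 0 < expZee e :=
  Finset.prod_pos fun _ _ => Nat.mul_pos (Nat.factorial_pos _) (pow_pos (Nat.succ_pos _) _)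

theorem expWeight_add (e f : ℕ →₀ ℕ) : expWeight (e + f) = expWeight e + expWeight f :=
  Finsupp.sum_add_index' (by simp) (by intros; ring)

theorem expWeight_single (i a : ℕ) : expWeight (Finsupp.single i a) = a * (i + 1) :=
  Finsupp.sum_single_index (by simp)

theorem expZee_add_single (e : ℕ →₀ ℕ) (i : ℕ) :
    expZee (e + Finsupp.single i 1) = expZee e * ((i + 1) * (e i + 1)) := by
  have key : ∀ f : ℕ →₀ ℕ, f.support ⊆ insert i e.support → expZee f =
      (∏ j ∈ e.support.erase i, ((f j).factorial * (j + 1) ^ f j)) *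
        ((f i).factorial * (i + 1) ^ f i) := by
    intro f hf
    rw [← Finset.erase_insert_eq_erase, Finset.prod_erase_mul _ _ (Finset.mem_insert_self _ _)]
    exact Finsupp.prod_of_support_subset _ hf _ (by simp)
  rw [key e (Finset.subset_insert _ _), key (e + Finsupp.single i 1)]
  · rw [Finset.prod_congr rfl (g := fun j => (e j).factorial * (j + 1) ^ e j)]
    · simp only [Finsupp.add_apply, Finsupp.single_eq_same, Nat.factorial_succ, pow_succ]
      ring
    · intro j hj
      simp [Finsupp.single_eq_of_ne (Finset.ne_of_mem_erase hj)]
  · refine Finsupp.support_add.trans (Finset.union_subset (Finset.subset_insert _ _) ?_)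
    exact Finsupp.support_single_subset.trans (by simp)

theorem pPart_eq_monomial {n : ℕ} (lam : n.Partition) :
    pPart lam = monomial (Multiset.toFinsupp (lam.parts.map (· - 1))) 1 := by
  unfold pPart
  induction lam.parts using Multiset.induction_on with
  | empty => simp
  | cons a s ih =>
    rw [Multiset.map_cons, Multiset.prod_cons, ih, Multiset.map_cons, ← Multiset.singleton_add,
      Multiset.toFinsupp_add, Multiset.toFinsupp_singleton, pSym, X, monomial_mul, one_mul]

theorem expWeight_eq_sum (e : ℕ →₀ ℕ) :
    ((Finsupp.toMultiset e).map (· + 1)).sum = expWeight e := by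
  induction e using Finsupp.induction_linear with
  | zero => simp [expWeight]
  | add f g hf hg => rw [map_add, Multiset.map_add, Multiset.sum_add, hf, hg, expWeight_add]
  | single i a => simp [expWeight_single, Multiset.map_nsmul, Multiset.sum_nsmul]

theorem coeff_hSym (n : ℕ) (e : ℕ →₀ ℕ) :
    (hSym n).coeff e = if expWeight e = n then (expZee e : ℚ)⁻¹ else 0 := by
  have hpred : ∀ lam : n.Partition, (lam.parts.map (· - 1)).map (· + 1) = lam.parts := by
    intro lam
    rw [Multiset.map_map]
    conv_rhs => rw [← Multiset.map_id lam.parts]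
    refine Multiset.map_congr rfl fun a ha => ?_
    have := lam.parts_pos ha
    simp only [Function.comp, id]
    omega
  have hparts : ∀ lam : n.Partition, Multiset.toFinsupp (lam.parts.map (· - 1)) = e →
      lam.parts = (Finsupp.toMultiset e).map (· + 1) := by
    rintro lam rfl
    rw [Multiset.toFinsupp_toMultiset, hpred]
  simp only [hSym, coeff_sum, coeff_smul, pPart_eq_monomial, coeff_monomial, smul_eq_mul,
    mul_ite, mul_one, mul_zero]
  split_ifs with h
  · have hsum := expWeight_eq_sum e
    rw [h] at hsum
    let l0 : n.Partition := ⟨(Finsupp.toMultiset e).map (· + 1), by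
      intro i hi
      obtain ⟨j, _, rfl⟩ := Multiset.mem_map.1 hi
      omega, hsum⟩
    have hl0 : Multiset.toFinsupp (l0.parts.map (· - 1)) = e := by
      simp [l0, Multiset.map_map]
    rw [Finset.sum_eq_single l0]
    · rw [if_pos hl0, ← zee_map_succ]
    · intro l _ hl
      rw [if_neg fun h' => hl (Nat.Partition.ext (hparts l h'))]
    · simp
  · refine Finset.sum_eq_zero fun l _ => if_neg fun h' => h ?_
    rw [← expWeight_eq_sum, ← hparts l h', l.parts_sum]

theorem hSym_zero : hSym 0 = 1 := by
  ext e
  rw [coeff_hSym, coeff_one]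
  by_cases h : e = 0
  · subst h
    simp [expWeight, expZee]
  · rw [if_neg, if_neg (Ne.symm h)]
    intro h0
    apply h
    ext i
    by_contra hi
    have := (Finset.sum_eq_zero_iff.1 h0) i (Finsupp.mem_support_iff.2 hi)
    simp_all

/-- Raising the exponent of `X i` by one multiplies z by `(i + 1) * (e i + 1)`: the derivative
cancels the second factor, the scalar the first. -/
theorem pderiv_hSym (n i : ℕ) :
    ((i + 1 : ℕ) : ℚ) • pderiv i (hSym n) = if i + 1 ≤ n then hSym (n - (i + 1)) else 0 := by
  ext e
  rw [coeff_smul, coeff_pderiv, coeff_hSym, expWeight_add, expWeight_single, expZee_add_single]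
  have h1 := expZee_pos e
  split_ifs with h2 h3 h3
  · rw [coeff_hSym, if_pos (by omega)]
    push_cast
    rw [smul_eq_mul]
    have : (expZee e : ℚ) ≠ 0 := by positivity
    have : ((e i : ℚ) + 1) ≠ 0 := by positivity
    have : ((i : ℚ) + 1) ≠ 0 := by positivity
    field_simp
  · omega
  · rw [coeff_hSym, if_neg (by omega)]
    simp
  · simp

/-- Newton's recursion `n h_n = p_1 h_{n-1} + ⋯ + p_n h_0`. -/
theorem natCast_smul_hSym (n : ℕ) :
    (n : ℚ) • hSym n = ∑ i ∈ range n, X i * hSym (n - (i + 1)) := by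
  ext e
  rw [coeff_smul, coeff_sum, coeff_hSym]
  -- The `i`-th summand contributes the share `e i * (i + 1)` of the weight; the shares add up to
  -- `expWeight e = n`.
  have hterm : ∀ i ∈ range n, (X i * hSym (n - (i + 1))).coeff e =
      if expWeight e = n then ((e i * (i + 1) : ℕ) : ℚ) * (expZee e : ℚ)⁻¹ else 0 := by
    intro i hi
    rw [Finset.mem_range] at hi
    rw [coeff_X_mul']
    by_cases h0 : i ∈ e.support
    · obtain ⟨f, rfl⟩ : ∃ f, e = f + Finsupp.single i 1 := by
        refine ⟨e - Finsupp.single i 1, (tsub_add_cancel_of_le ?_).symm⟩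
        rw [Finsupp.single_le_iff]
        exact Nat.one_le_iff_ne_zero.2 (Finsupp.mem_support_iff.1 h0)
      rw [if_pos h0, add_tsub_cancel_right, coeff_hSym, expWeight_add, expWeight_single,
        expZee_add_single]
      have h1 := expZee_pos f
      have : (expZee f : ℚ) ≠ 0 := by positivity
      have : ((f i : ℚ) + 1) ≠ 0 := by positivity
      have : ((i : ℚ) + 1) ≠ 0 := by positivity
      split_ifs with h2 h3 h3
      · simp only [Finsupp.add_apply, Finsupp.single_eq_same]
        push_cast
        field_simp
      · omega
      · omega
      · rfl
    · rw [if_neg h0, Finsupp.notMem_support_iff.1 h0]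
      simp
  rw [Finset.sum_congr rfl hterm]
  split_ifs with h
  · rw [← Finset.sum_mul, ← Nat.cast_sum, smul_eq_mul]
    congr 2
    rw [← h]
    refine Finsupp.sum_of_support_subset _ (fun i hi => ?_) _ (by simp)
    rw [Finset.mem_range]
    calc i < e i * (i + 1) :=
          Nat.lt_of_lt_of_le (Nat.lt_succ_self i) (Nat.le_mul_of_pos_left _
            (Nat.pos_of_ne_zero (Finsupp.mem_support_iff.1 hi)))
      _ ≤ expWeight e := Finset.single_le_sum (f := fun i => e i * (i + 1))
          (fun _ _ => Nat.zero_le _) hi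
  · simp

end CharBasis

namespace CharBasis

open Finset MvPolynomial

/-! ### Evaluation at a cycle type -/

/-- The evaluation of a symmetric function at the eigenvalues of a permutation whose cycles are
indexed by `ι`, the cycle `c` having length `m c + 1`: it maps `p_j` to the number of fixed points
of the `j`-th power of the permutation. -/
noncomputable def evalCycles {ι : Type*} [Fintype ι] (m : ι → ℕ) : SymFun →ₐ[ℚ] ℚ :=
  aeval fun i => ∑ c, if m c + 1 ∣ i + 1 then ((m c + 1 : ℕ) : ℚ) else 0

theorem evalCycles_X {ι : Type*} [Fintype ι] (m : ι → ℕ) (i : ℕ) :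
    evalCycles m (X i) = ∑ c, if m c + 1 ∣ i + 1 then ((m c + 1 : ℕ) : ℚ) else 0 :=
  aeval_X _ _

theorem evalCycles_comp_equiv {ι κ : Type*} [Fintype ι] [Fintype κ] (m : ι → ℕ) (e : κ ≃ ι) :
    evalCycles (m ∘ e) = evalCycles m := by
  refine MvPolynomial.algHom_ext fun i => ?_
  rw [evalCycles_X, evalCycles_X]
  exact e.sum_comp fun c => if m c + 1 ∣ i + 1 then ((m c + 1 : ℕ) : ℚ) else 0

/-- The change of variables `p_j ↦ ∑_{d ∣ j} d x_d`. -/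
noncomputable def divisorSub : SymFun →ₐ[ℚ] SymFun :=
  aeval fun i => ∑ d ∈ (i + 1).divisors, (d : ℚ) • X (d - 1)

/-- The images of the variables under the inverse of `divisorSub`. -/
noncomputable def divisorInv : ℕ → SymFun
  | i => ((i + 1 : ℕ) : ℚ)⁻¹ • (X i - ∑ d ∈ (i + 1).properDivisors.attach,
      (d.1 : ℚ) • divisorInv (d.1 - 1))
decreasing_by
  have h1 := Nat.mem_properDivisors.1 d.2
  have h2 := Nat.pos_of_mem_properDivisors d.2
  omega

theorem sum_divisorInv (i : ℕ) :
    ∑ d ∈ (i + 1).divisors, (d : ℚ) • divisorInv (d - 1) = X i := by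
  rw [← Nat.cons_self_properDivisors (Nat.succ_ne_zero i), Finset.sum_cons, Nat.succ_sub_one,
    divisorInv, smul_smul, mul_inv_cancel₀ (by positivity), one_smul,
    Finset.sum_attach _ (fun d : ℕ => (d : ℚ) • divisorInv (d - 1)), sub_add_cancel]

/-- The substitution is triangular with diagonal entries `i + 1 ≠ 0`, so it can be solved
recursively for a left inverse. -/
theorem divisorSub_injective : Function.Injective divisorSub := by
  have h : (aeval divisorInv).comp divisorSub = AlgHom.id ℚ SymFun := by
    refine MvPolynomial.algHom_ext fun i => ?_
    simp only [AlgHom.comp_apply, divisorSub, aeval_X, map_sum, map_smul, AlgHom.id_apply]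
    exact sum_divisorInv i
  intro f g hfg
  have := congrArg (aeval divisorInv) hfg
  simpa only [← AlgHom.comp_apply, h, AlgHom.id_apply] using this

/-- With `a i` cycles of length `i + 1` for `i < N`, the `j`-th power fixes exactly the points on
cycles of length dividing `j`. In the variables of `divisorSub`, evaluating therefore means
inserting the cycle multiplicities. -/
theorem aeval_divisorSub_eq_evalCycles (N : ℕ) (a : ℕ → ℕ) :
    (aeval fun i => if i < N then (a i : ℚ) else 0).comp divisorSub =
      evalCycles (fun c : Σ i : Fin N, Fin (a i) => (c.1 : ℕ)) := by
  refine MvPolynomial.algHom_ext fun i => ?_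
  simp only [AlgHom.comp_apply, divisorSub, evalCycles_X, aeval_X, map_sum, map_smul]
  rw [Fintype.sum_sigma]
  simp only [Finset.sum_const, Finset.card_univ, Fintype.card_fin, smul_ite, smul_zero]
  rw [Fin.sum_univ_eq_sum_range
    (fun c => if c + 1 ∣ i + 1 then a c • ((c + 1 : ℕ) : ℚ) else 0) N,
    ← Finset.sum_filter, ← Finset.sum_filter]
  refine Finset.sum_nbij' (fun d => d - 1) (fun c => c + 1) ?_ ?_ ?_ ?_ ?_
  · intro d hd
    simp only [Finset.mem_filter, Nat.mem_divisors, Finset.mem_range] at hd ⊢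
    have := Nat.pos_of_dvd_of_pos hd.1.1 (Nat.succ_pos i)
    rw [Nat.sub_add_cancel this]
    exact ⟨hd.2, hd.1.1⟩
  · intro c hc
    simp only [Finset.mem_filter, Nat.mem_divisors, Finset.mem_range] at hc ⊢
    exact ⟨⟨hc.2, Nat.succ_ne_zero i⟩, hc.1⟩
  · intro d hd
    simp only [Finset.mem_filter, Nat.mem_divisors] at hd
    have := Nat.pos_of_dvd_of_pos hd.1.1 (Nat.succ_pos i)
    omega
  · intro c _
    simp
  · intro d hd
    simp only [Finset.mem_filter, Nat.mem_divisors] at hd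
    have := Nat.pos_of_dvd_of_pos hd.1.1 (Nat.succ_pos i)
    rw [Nat.sub_add_cancel this, smul_eq_mul, nsmul_eq_mul, mul_comm]

/-- Symmetric functions are determined by their evaluations at all cycle types. -/
theorem ext_evalCycles {f g : SymFun}
    (h : ∀ (k : ℕ) (m : Fin k → ℕ), evalCycles m f = evalCycles m g) : f = g := by
  apply divisorSub_injective
  -- A polynomial is determined by its values at points with natural coordinates; such points are
  -- cycle multiplicities.
  refine MvPolynomial.funext_set (fun _ => Set.range (Nat.cast : ℕ → ℚ))
    (fun _ => Set.infinite_range_of_injective Nat.cast_injective) fun x hx => ?_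
  choose a ha using fun i => hx i (Set.mem_univ i)
  -- Only finitely many variables occur, so truncating at `N` leaves finitely many cycles without
  -- changing the values.
  obtain ⟨N, hN⟩ : ∃ N, ∀ i ∈ (divisorSub f).vars ∪ (divisorSub g).vars, i < N :=
    ⟨_, fun i hi => Nat.lt_succ_of_le (Finset.le_sup (f := id) hi)⟩
  have htrunc : ∀ p : SymFun, (∀ i ∈ p.vars, i < N) →
      eval x p = aeval (fun i => if i < N then (a i : ℚ) else 0) p := by
    intro p hp
    rw [MvPolynomial.aeval_def, ← MvPolynomial.coe_eval₂Hom]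
    refine MvPolynomial.eval₂Hom_congr' (by ext; rfl) (fun i hi _ => ?_) rfl
    rw [if_pos (hp i hi), ha]
  have hsep : ∀ {ι : Type} [Fintype ι] (m : ι → ℕ), evalCycles m f = evalCycles m g := by
    intro ι _ m
    rw [← evalCycles_comp_equiv m (Fintype.equivFin ι).symm]
    exact h _ _
  rw [htrunc _ fun i hi => hN i (Finset.mem_union_left _ hi),
    htrunc _ fun i hi => hN i (Finset.mem_union_right _ hi), ← AlgHom.comp_apply,
    ← AlgHom.comp_apply, aeval_divisorSub_eq_evalCycles, hsep]

/-! ### Evaluation of `h_n` -/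

variable {k : ℕ}

/-- The functions on the cycles of total weight `n`. -/
def weightedCompositions (m : Fin k → ℕ) (n : ℕ) : Finset (Fin k → ℕ) :=
  (Fintype.piFinset fun _ => range (n + 1)).filter fun f => ∑ c, (m c + 1) * f c = n

theorem mem_weightedCompositions {m : Fin k → ℕ} {n : ℕ} {f : Fin k → ℕ} :
    f ∈ weightedCompositions m n ↔ ∑ c, (m c + 1) * f c = n := by
  simp only [weightedCompositions, Finset.mem_filter, Fintype.mem_piFinset, Finset.mem_range,
    and_iff_right_iff_imp]
  rintro rfl c
  exact Nat.lt_succ_of_le ((Nat.le_mul_of_pos_left _ (Nat.succ_pos _)).trans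
    (Finset.single_le_sum (f := fun c => (m c + 1) * f c) (fun _ _ => Nat.zero_le _)
      (Finset.mem_univ c)))

theorem piSingle_le {f : Fin k → ℕ} {c : Fin k} {q : ℕ} (h : q ≤ f c) : Pi.single c q ≤ f := by
  intro b
  by_cases hb : b = c
  · subst hb
    simpa using h
  · simp [Pi.single_eq_of_ne hb]

theorem sum_mul_add_single (m f : Fin k → ℕ) (c : Fin k) (q : ℕ) :
    ∑ b, (m b + 1) * (f + Pi.single c q : Fin k → ℕ) b = ∑ b, (m b + 1) * f b + (m c + 1) * q := by
  simp only [Pi.add_apply, mul_add, Finset.sum_add_distrib, add_right_inj]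
  rw [Finset.sum_eq_single c] <;> simp +contextual

theorem card_weightedCompositions_filter (m : Fin k → ℕ) (n q : ℕ) (c : Fin k)
    (hq : (m c + 1) * q ≤ n) :
    ((weightedCompositions m n).filter fun f => q ≤ f c).card =
      (weightedCompositions m (n - (m c + 1) * q)).card := by
  refine Finset.card_nbij' (fun f => f - Pi.single c q) (fun f => f + Pi.single c q) ?_ ?_ ?_ ?_
  · intro f hf
    simp only [Finset.coe_filter, Set.mem_ofPred_eq, Finset.mem_coe,
      mem_weightedCompositions] at hf ⊢
    obtain ⟨g, rfl⟩ : ∃ g, f = g + Pi.single c q :=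
      ⟨f - Pi.single c q, (tsub_add_cancel_of_le (piSingle_le hf.2)).symm⟩
    rw [sum_mul_add_single] at hf
    rw [add_tsub_cancel_right]
    omega
  · intro f hf
    simp only [Finset.coe_filter, Set.mem_ofPred_eq, Finset.mem_coe,
      mem_weightedCompositions] at hf ⊢
    rw [sum_mul_add_single]
    simp only [Pi.add_apply, Pi.single_eq_same]
    omega
  · intro f hf
    simp only [Finset.coe_filter, Set.mem_ofPred_eq] at hf
    exact tsub_add_cancel_of_le (piSingle_le hf.2)
  · intro f _
    exact add_tsub_cancel_right _ _

/-- `f c` is the number of positive multiples of `m c + 1` up to `(m c + 1) * f c`. Exchanging the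
sums and removing each multiple from the cycle `c` leaves a composition of smaller weight. -/
theorem sum_weightedCompositions (m : Fin k → ℕ) (n : ℕ) (c : Fin k) :
    ∑ f ∈ weightedCompositions m n, f c =
      ∑ i ∈ range n, if m c + 1 ∣ i + 1 then (weightedCompositions m (n - (i + 1))).card else 0 := by
  have hcount : ∀ f ∈ weightedCompositions m n, f c =
      ∑ i ∈ range n, if m c + 1 ∣ i + 1 ∧ i + 1 ≤ (m c + 1) * f c then 1 else 0 := by
    intro f hf
    rw [mem_weightedCompositions] at hf
    have hle : (m c + 1) * f c ≤ n := hf ▸ Finset.single_le_sum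
      (f := fun c => (m c + 1) * f c) (fun _ _ => Nat.zero_le _) (Finset.mem_univ c)
    rw [← Finset.card_filter]
    conv_lhs => rw [← Finset.card_range (f c)]
    -- The index `i` stands for the multiple `i + 1`, hence the shift by one.
    refine Finset.card_nbij (fun j => (m c + 1) * (j + 1) - 1) ?_ ?_ ?_
    · intro j hj
      simp only [Finset.coe_range, Set.mem_Iio, Finset.coe_filter, Finset.mem_range,
        Set.mem_ofPred_eq] at hj ⊢
      have h1 : (m c + 1) * (j + 1) ≤ (m c + 1) * f c := Nat.mul_le_mul_left _ hj
      have h2 : 0 < (m c + 1) * (j + 1) := by positivity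
      rw [Nat.sub_add_cancel h2]
      exact ⟨by omega, dvd_mul_right _ _, h1⟩
    · intro i _ j _ hij
      have h1 : 0 < (m c + 1) * (i + 1) := by positivity
      have h2 : 0 < (m c + 1) * (j + 1) := by positivity
      have h3 : (m c + 1) * (i + 1) = (m c + 1) * (j + 1) := by
        simp only at hij
        omega
      have := Nat.eq_of_mul_eq_mul_left (Nat.succ_pos _) h3
      omega
    · intro i hi
      simp only [Finset.coe_filter, Finset.mem_range, Set.mem_ofPred_eq] at hi
      obtain ⟨_, ⟨q, hq⟩, h3⟩ := hi
      have hq0 : q ≠ 0 := by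
        rintro rfl
        simp at hq
      rw [hq] at h3
      refine ⟨q - 1, ?_, ?_⟩
      · have := Nat.le_of_mul_le_mul_left h3 (Nat.succ_pos _)
        simp only [Finset.coe_range, Set.mem_Iio]
        omega
      · simp only [Nat.sub_add_cancel (Nat.pos_of_ne_zero hq0)]
        omega
  rw [Finset.sum_congr rfl hcount, Finset.sum_comm]
  refine Finset.sum_congr rfl fun i hi => ?_
  rw [Finset.mem_range] at hi
  split_ifs with h
  · obtain ⟨q, hq⟩ := h
    rw [hq, ← card_weightedCompositions_filter m n q c (by omega), Finset.card_filter]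
    refine Finset.sum_congr rfl fun f _ => ?_
    simp only [dvd_mul_right, true_and, Nat.mul_le_mul_left_iff (Nat.succ_pos (m c))]
  · simp [h]

/-- A multiset of points fixed by the permutation has constant multiplicity on each cycle, and h_n
counts those of size `n`. The proof shows that the count obeys Newton's recursion. -/
theorem evalCycles_hSym (m : Fin k → ℕ) (n : ℕ) :
    evalCycles m (hSym n) = (weightedCompositions m n).card := by
  induction n using Nat.strong_induction_on with
  | _ n ih =>
    rcases Nat.eq_zero_or_pos n with rfl | hn
    · have : weightedCompositions m 0 = {0} := by
        ext f
        simp [mem_weightedCompositions, funext_iff]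
      rw [hSym_zero, map_one, this, Finset.card_singleton, Nat.cast_one]
    · have h1 : (n : ℚ) * evalCycles m (hSym n) = n * (weightedCompositions m n).card := by
        -- Each factor `n` is expanded as the weight of the composition being counted.
        have h2 : n * (weightedCompositions m n).card =
            ∑ c, (m c + 1) * ∑ f ∈ weightedCompositions m n, f c := by
          simp only [Finset.mul_sum]
          rw [Finset.sum_comm, Finset.sum_congr rfl fun f hf => mem_weightedCompositions.1 hf,
            Finset.sum_const, smul_eq_mul, mul_comm]
        rw [← smul_eq_mul, ← map_smul, natCast_smul_hSym, map_sum, ← Nat.cast_mul, h2]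
        simp only [sum_weightedCompositions, Finset.mul_sum]
        rw [Finset.sum_comm, Nat.cast_sum]
        refine Finset.sum_congr rfl fun i hi => ?_
        rw [Finset.mem_range] at hi
        rw [map_mul, evalCycles_X, ih _ (by omega), Finset.sum_mul, Nat.cast_sum]
        refine Finset.sum_congr rfl fun c _ => ?_
        split_ifs <;> simp
      exact mul_left_cancel₀ (by positivity) h1

end CharBasis

namespace CharBasis

open Finset MvPolynomial

variable {k : ℕ}

/-! ### The power sum expansion of products of complete symmetric functions -/

/-- The exponent vector of the cycle type with cycles of lengths `m c + 1`. -/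
noncomputable def cycleExponent (m : Fin k → ℕ) : ℕ →₀ ℕ := ∑ c, Finsupp.single (m c) 1

theorem cycleExponent_cons (i : ℕ) (m : Fin k → ℕ) :
    cycleExponent (Fin.cons i m : Fin (k + 1) → ℕ) = cycleExponent m + Finsupp.single i 1 := by
  simp [cycleExponent, Fin.sum_univ_succ, add_comm]

theorem exists_cycleExponent_eq (e : ℕ →₀ ℕ) :
    ∃ (k : ℕ) (m : Fin k → ℕ), cycleExponent m = e := by
  suffices h : ∀ s : Multiset ℕ, ∃ (k : ℕ) (m : Fin k → ℕ),
      cycleExponent m = Multiset.toFinsupp s by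
    simpa using h (Finsupp.toMultiset e)
  intro s
  induction s using Multiset.induction_on with
  | empty => exact ⟨0, Fin.elim0, by simp [cycleExponent]⟩
  | cons i s ih =>
    obtain ⟨k, m, hm⟩ := ih
    refine ⟨k + 1, Fin.cons i m, ?_⟩
    rw [cycleExponent_cons, hm, ← Multiset.singleton_add, Multiset.toFinsupp_add,
      Multiset.toFinsupp_singleton, add_comm]

/-- The value on the cycle type `m` of the class function with Frobenius image `f`. -/
noncomputable def charValue (m : Fin k → ℕ) (f : SymFun) : ℚ :=
  expZee (cycleExponent m) * f.coeff (cycleExponent m)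

/-- Peeling off one cycle is differentiation: the factor gained by z is the scalar times the factor
produced by the derivative. This drives the induction on the number of cycles. -/
theorem charValue_cons (i : ℕ) (m : Fin k → ℕ) (f : SymFun) :
    charValue (Fin.cons i m : Fin (k + 1) → ℕ) f =
      charValue m (((i + 1 : ℕ) : ℚ) • pderiv i f) := by
  rw [charValue, charValue, cycleExponent_cons, expZee_add_single, coeff_smul, coeff_pderiv,
    smul_eq_mul]
  push_cast
  ring

theorem pderiv_prod {β : Type*} [DecidableEq β] (i : ℕ) (J : Finset β) (f : β → SymFun) :
    pderiv i (∏ j ∈ J, f j) = ∑ j ∈ J, (∏ b ∈ J.erase j, f b) * pderiv i (f j) := by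
  induction J using Finset.induction_on with
  | empty => simp
  | insert a J ha ih =>
    rw [Finset.prod_insert ha, pderiv_mul, ih, Finset.sum_insert ha, Finset.erase_insert ha,
      mul_comm (pderiv i (f a)), Finset.mul_sum]
    congr 1
    refine Finset.sum_congr rfl fun j hj => ?_
    have hne : a ≠ j := fun h => ha (h ▸ hj)
    rw [Finset.erase_insert_of_ne hne, Finset.prod_insert fun h => ha (Finset.mem_of_mem_erase h),
      mul_assoc]

variable {β : Type*} [DecidableEq β]

theorem pderiv_prod_hSym (i : ℕ) (J : Finset β) (a : β → ℕ) :
    ((i + 1 : ℕ) : ℚ) • pderiv i (∏ j ∈ J, hSym (a j)) =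
      ∑ j ∈ J, if i + 1 ≤ a j then ∏ b ∈ J, hSym (Function.update a j (a j - (i + 1)) b) else 0 := by
  rw [pderiv_prod, Finset.smul_sum]
  refine Finset.sum_congr rfl fun j hj => ?_
  rw [← mul_smul_comm, pderiv_hSym]
  split_ifs with h
  · rw [← Finset.prod_erase_mul J _ hj, Function.update_self]
    congr 1
    refine Finset.prod_congr rfl fun b hb => ?_
    rw [Function.update_of_ne (Finset.ne_of_mem_erase hb)]
  · rw [mul_zero]

/-- The colorings of the cycles by the elements of `J` in which the color `j` has total
weight `a j`. -/
def classColorings (m : Fin k → ℕ) (J : Finset β) (a : β → ℕ) : Finset (Fin k → β) :=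
  (Fintype.piFinset fun _ => J).filter
    fun F => ∀ j ∈ J, (∑ c, if F c = j then m c + 1 else 0) = a j

theorem mem_classColorings {m : Fin k → ℕ} {J : Finset β} {a : β → ℕ} {F : Fin k → β} :
    F ∈ classColorings m J a ↔
      (∀ c, F c ∈ J) ∧ ∀ j ∈ J, (∑ c, if F c = j then m c + 1 else 0) = a j := by
  simp [classColorings]

/-- Sorting by the color of the first cycle gives the recursion that the Leibniz rule gives in
`pderiv_prod_hSym`. -/
theorem card_classColorings_cons (i : ℕ) (m : Fin k → ℕ) (J : Finset β) (a : β → ℕ) :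
    (classColorings (Fin.cons i m : Fin (k + 1) → ℕ) J a).card =
      ∑ j ∈ J, if i + 1 ≤ a j then
        (classColorings m J (Function.update a j (a j - (i + 1)))).card else 0 := by
  have hmem : ∀ (j : β) (F : Fin k → β), j ∈ J →
      ((Fin.cons j F : Fin (k + 1) → β) ∈
        classColorings (Fin.cons i m : Fin (k + 1) → ℕ) J a ↔
      i + 1 ≤ a j ∧ F ∈ classColorings m J (Function.update a j (a j - (i + 1)))) := by
    intro j F hj
    simp only [mem_classColorings, Fin.forall_fin_succ, Fin.sum_univ_succ, Fin.cons_zero,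
      Fin.cons_succ, hj, true_and]
    constructor
    · rintro ⟨h1, h2⟩
      have h3 := h2 j hj
      rw [if_pos rfl] at h3
      refine ⟨by omega, h1, fun b hb => ?_⟩
      have h4 := h2 b hb
      by_cases hbj : b = j
      · subst hbj
        rw [Function.update_self]
        omega
      · rw [if_neg (Ne.symm hbj), zero_add] at h4
        rw [Function.update_of_ne hbj, h4]
    · rintro ⟨h0, h1, h2⟩
      refine ⟨h1, fun b hb => ?_⟩
      have h4 := h2 b hb
      by_cases hbj : b = j
      · subst hbj
        rw [Function.update_self] at h4
        rw [if_pos rfl]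
        omega
      · rw [Function.update_of_ne hbj] at h4
        rw [if_neg (Ne.symm hbj), zero_add, h4]
  rw [Finset.card_eq_sum_card_fiberwise (f := fun F => F 0) (t := J)
    fun F hF => (mem_classColorings.1 hF).1 0]
  refine Finset.sum_congr rfl fun j hj => ?_
  split_ifs with h
  · refine Finset.card_nbij' (fun F => Fin.tail F) (fun F => Fin.cons j F) ?_ ?_ ?_ ?_
    · intro F hF
      simp only [Finset.coe_filter, Set.mem_ofPred_eq] at hF
      obtain ⟨h1, rfl⟩ := hF
      rw [← Fin.cons_self_tail F, hmem _ _ hj] at h1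
      exact h1.2
    · intro F hF
      simp only [Finset.coe_filter, Set.mem_ofPred_eq, Fin.cons_zero, and_true]
      exact (hmem j F hj).2 ⟨h, hF⟩
    · intro F hF
      simp only [Finset.coe_filter, Set.mem_ofPred_eq] at hF
      obtain ⟨_, rfl⟩ := hF
      exact Fin.cons_self_tail F
    · intro F _
      exact Fin.tail_cons _ _
  · rw [Finset.card_eq_zero, Finset.filter_eq_empty_iff]
    rintro F hF rfl
    rw [← Fin.cons_self_tail F, hmem _ _ hj] at hF
    exact h hF.1

theorem charValue_prod_hSym (m : Fin k → ℕ) (J : Finset β) (a : β → ℕ) :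
    charValue m (∏ j ∈ J, hSym (a j)) = (classColorings m J a).card := by
  induction k generalizing a with
  | zero =>
    have h0 : cycleExponent m = 0 := by simp [cycleExponent]
    -- Without cycles the value is the constant term, which is 1 if all `a j` vanish and 0
    -- otherwise; so is the number of colorings.
    rw [charValue, h0, ← constantCoeff_eq, map_prod]
    have h1 : ∀ j, constantCoeff (hSym (a j)) = if 0 = a j then (1 : ℚ) else 0 := by
      intro j
      rw [constantCoeff_eq, coeff_hSym]
      simp [expWeight, expZee]
    simp only [h1]
    rw [Finset.prod_ite_zero]
    simp [expZee, classColorings, Finset.filter_const, apply_ite Finset.card]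
  | succ k ih =>
    rw [← Fin.cons_self_tail m, charValue_cons, pderiv_prod_hSym, card_classColorings_cons]
    rw [charValue, coeff_sum, Finset.mul_sum, Nat.cast_sum]
    refine Finset.sum_congr rfl fun j _ => ?_
    split_ifs
    · exact ih _ _
    · simp

/-! ### Colorings of cycles by multisets -/

variable {α : Type*} [DecidableEq α]

/-- The multiset of the nonempty labels of a labelling of the cycles by multisets, where each
cycle counts with its length. -/
def labelType (m : Fin k → ℕ) (F : Fin k → Multiset α) : Multiset (Multiset α) :=
  (∑ c, Multiset.replicate (m c + 1) (F c)).filter (· ≠ 0)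

theorem count_labelType (m : Fin k → ℕ) (F : Fin k → Multiset α) {A : Multiset α} (hA : A ≠ 0) :
    (labelType m F).count A = ∑ c, if F c = A then m c + 1 else 0 := by
  rw [labelType, Multiset.count_filter_of_pos (p := (· ≠ 0)) hA, Multiset.count_sum']
  simp only [Multiset.count_replicate]

theorem mem_labelType {m : Fin k → ℕ} {F : Fin k → Multiset α} {A : Multiset α} :
    A ∈ labelType m F ↔ A ≠ 0 ∧ ∃ c, F c = A := by
  simp only [labelType, Multiset.mem_filter, Multiset.mem_sum, Finset.mem_univ, true_and,
    Multiset.mem_replicate]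
  constructor
  · rintro ⟨⟨c, _, rfl⟩, h⟩
    exact ⟨h, c, rfl⟩
  · rintro ⟨h, c, rfl⟩
    exact ⟨⟨c, Nat.succ_ne_zero _, rfl⟩, h⟩

/-- The labellings of the cycles by multisets with `labelType m F = π`. -/
def labellings (m : Fin k → ℕ) (π : Multiset (Multiset α)) : Finset (Fin k → Multiset α) :=
  (Fintype.piFinset fun _ => insert 0 π.toFinset).filter fun F => labelType m F = π

theorem mem_labellings {m : Fin k → ℕ} {π : Multiset (Multiset α)} {F : Fin k → Multiset α} :
    F ∈ labellings m π ↔ labelType m F = π := by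
  simp only [labellings, Finset.mem_filter, Fintype.mem_piFinset, Finset.mem_insert,
    Multiset.mem_toFinset, and_iff_right_iff_imp]
  rintro rfl c
  rw [mem_labelType, or_iff_not_imp_left]
  exact fun h => ⟨h, c, rfl⟩

theorem card_labelType_le (m : Fin k → ℕ) (F : Fin k → Multiset α) :
    Multiset.card (labelType m F) ≤ ∑ c, (m c + 1) := by
  refine (Multiset.card_le_card (Multiset.filter_le _ _)).trans ?_
  simp

/-- The empty multiset serves as an extra color for the factor h_r, so that the product is indexed
by all admissible labels. -/
theorem hSym_mul_hPart_mTilde {π : Multiset (Multiset α)} (h0 : 0 ∉ π) (r : ℕ) :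
    hSym r * hPart (mTilde π) =
      ∏ A ∈ insert 0 π.toFinset, hSym (if A = 0 then r else π.count A) := by
  rw [Finset.prod_insert (by simpa using h0), if_pos rfl]
  congr 1
  rw [hPart, mTilde, Multiset.map_map]
  refine Finset.prod_congr rfl fun A hA => ?_
  rw [if_neg]
  · rfl
  · rintro rfl
    exact h0 (Multiset.mem_toFinset.1 hA)

/-- The nonempty colors prescribe the type π; the weight `n - ℓ(π)` of the empty color then only
says that the cycles have total length `n`. By `hn` the subtraction is not truncated. -/
theorem classColorings_eq_labellings (m : Fin k → ℕ) {π : Multiset (Multiset α)} (h0 : 0 ∉ π)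
    {n : ℕ} (hn : Multiset.card π ≤ n) :
    classColorings m (insert 0 π.toFinset)
        (fun A => if A = 0 then n - Multiset.card π else π.count A) =
      if ∑ c, (m c + 1) = n then labellings m π else ∅ := by
  have hsplit : ∀ F : Fin k → Multiset α, (∀ c, F c ∈ insert 0 π.toFinset) →
      ∑ c, (m c + 1) = ∑ A ∈ insert 0 π.toFinset, ∑ c, if F c = A then m c + 1 else 0 := by
    intro F hF
    rw [Finset.sum_comm]
    refine Finset.sum_congr rfl fun c _ => ?_
    rw [Finset.sum_ite_eq, if_pos (hF c)]
  have h0' : (0 : Multiset α) ∉ π.toFinset := by simpa using h0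
  have hcount : ∑ A ∈ π.toFinset, π.count A = Multiset.card π := Multiset.toFinset_sum_count_eq π
  have hlabel : ∀ F : Fin k → Multiset α, (∀ c, F c ∈ insert 0 π.toFinset) →
      (labelType m F = π ↔
        ∀ A ∈ π.toFinset, (∑ c, if F c = A then m c + 1 else 0) = π.count A) := by
    intro F hF
    constructor
    · rintro h A hA
      rw [← count_labelType, h]
      rintro rfl
      exact h0' hA
    · intro h
      ext A
      by_cases hA0 : A = 0
      · subst hA0
        rw [Multiset.count_eq_zero_of_notMem h0, Multiset.count_eq_zero_of_notMem]
        simp [mem_labelType]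
      rw [count_labelType m F hA0]
      by_cases hA : A ∈ π.toFinset
      · exact h A hA
      · rw [Multiset.count_eq_zero_of_notMem (by simpa using hA)]
        refine Finset.sum_eq_zero fun c _ => if_neg ?_
        rintro rfl
        rcases Finset.mem_insert.1 (hF c) with h' | h'
        · exact hA0 h'
        · exact hA h'
  ext F
  rw [mem_classColorings]
  constructor
  · rintro ⟨h1, h2⟩
    have h3 : ∀ A ∈ π.toFinset, (∑ c, if F c = A then m c + 1 else 0) = π.count A := by
      intro A hA
      rw [h2 A (Finset.mem_insert_of_mem hA), if_neg]
      rintro rfl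
      exact h0' hA
    rw [if_pos, mem_labellings, hlabel F h1]
    · exact h3
    · rw [hsplit F h1, Finset.sum_insert h0', h2 0 (Finset.mem_insert_self _ _), if_pos rfl,
        Finset.sum_congr rfl h3, hcount]
      omega
  · intro h
    split_ifs at h with hm
    · have h1 : ∀ c, F c ∈ insert 0 π.toFinset := by
        intro c
        exact Fintype.mem_piFinset.1 (Finset.mem_filter.1 h).1 c
      have h3 := (hlabel F h1).1 (mem_labellings.1 h)
      refine ⟨h1, fun A hA => ?_⟩
      rcases Finset.mem_insert.1 hA with rfl | hA
      · rw [if_pos rfl]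
        have := hsplit F h1
        rw [Finset.sum_insert h0', Finset.sum_congr rfl h3, hcount, hm] at this
        omega
      · rw [h3 A hA, if_neg]
        rintro rfl
        exact h0' hA
    · simp at h

/-- `h_{n-ℓ(π)} h_{m̃(π)}` is the Frobenius image of the permutation character of the symmetric
group on labellings. -/
theorem charValue_hSym_mul_hPart (m : Fin k → ℕ) {π : Multiset (Multiset α)} (h0 : 0 ∉ π)
    {n : ℕ} (hn : Multiset.card π ≤ n) :
    charValue m (hSym (n - Multiset.card π) * hPart (mTilde π)) =
      if ∑ c, (m c + 1) = n then ((labellings m π).card : ℚ) else 0 := by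
  rw [hSym_mul_hPart_mTilde h0, charValue_prod_hSym, classColorings_eq_labellings m h0 hn]
  split_ifs <;> simp

theorem labellings_eq_empty {m : Fin k → ℕ} {π : Multiset (Multiset α)}
    (h : ∑ c, (m c + 1) < Multiset.card π) : labellings m π = ∅ := by
  rw [Finset.eq_empty_iff_forall_notMem]
  intro F hF
  rw [mem_labellings] at hF
  have := card_labelType_le m F
  rw [hF] at this
  omega

/-- The count is a character value of a product of h's that sees only the multiplicities. This
allows a change of alphabet, in particular from `α` to `ℕ`. -/
theorem card_labellings_eq_of_mTilde {γ : Type*} [DecidableEq γ] (m : Fin k → ℕ)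
    {π : Multiset (Multiset α)} {τ : Multiset (Multiset γ)} (hπ : 0 ∉ π) (hτ : 0 ∉ τ)
    (h : (mTilde π).parts = (mTilde τ).parts) :
    (labellings m π).card = (labellings m τ).card := by
  have hc : Multiset.card π = Multiset.card τ := by
    rw [← (mTilde π).parts_sum, h, (mTilde τ).parts_sum]
  -- Here `n` is taken to be the total cycle length; if ℓ(π) exceeds it, neither side has a
  -- labelling.
  by_cases hn : Multiset.card π ≤ ∑ c, (m c + 1)
  · have h1 := charValue_hSym_mul_hPart m hπ hn
    have h2 := charValue_hSym_mul_hPart m hτ (hc ▸ hn)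
    rw [hPart, h, hc] at h1
    rw [hPart, h1, if_pos rfl, if_pos rfl] at h2
    exact_mod_cast h2
  · rw [labellings_eq_empty (by omega), labellings_eq_empty (by omega)]
    rfl

end CharBasis

namespace CharBasis

open Finset MvPolynomial

variable {k : ℕ} {α : Type*} [DecidableEq α]

/-! ### Evaluation of the induced trivial character basis -/

theorem sum_filter_ne_zero (s : Multiset (Multiset α)) : (s.filter (· ≠ 0)).sum = s.sum := by
  induction s using Multiset.induction_on with
  | empty => rfl
  | cons A s ih =>
    by_cases hA : A = 0
    · subst hA
      rw [Multiset.filter_cons_of_neg _ (by simp), ih, Multiset.sum_cons, zero_add]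
    · rw [Multiset.filter_cons_of_pos (p := (· ≠ 0)) _ hA, Multiset.sum_cons, Multiset.sum_cons, ih]

theorem sum_labelType (m : Fin k → ℕ) (F : Fin k → Multiset α) :
    (labelType m F).sum = ∑ c, (m c + 1) • F c := by
  rw [labelType, sum_filter_ne_zero, Multiset.sum_sum]
  simp only [Multiset.sum_replicate]

/-- The labellings of the cycles by multisets with total content `S`. -/
def coverings (m : Fin k → ℕ) (S : Multiset α) : Finset (Fin k → Multiset α) :=
  (Fintype.piFinset fun _ => S.powerset.toFinset).filter fun H => ∑ c, (m c + 1) • H c = S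

theorem mem_coverings {m : Fin k → ℕ} {S : Multiset α} {H : Fin k → Multiset α} :
    H ∈ coverings m S ↔ ∑ c, (m c + 1) • H c = S := by
  simp only [coverings, Finset.mem_filter, Fintype.mem_piFinset, Multiset.mem_toFinset,
    Multiset.mem_powerset, and_iff_right_iff_imp]
  rintro rfl c
  refine le_trans ?_ (Finset.single_le_sum (f := fun c => (m c + 1) • H c)
    (fun _ _ => Multiset.zero_le _) (Finset.mem_univ c))
  simp only [succ_nsmul]
  exact Multiset.le_add_left _ _

theorem card_coverings_eq_sum (m : Fin k → ℕ) (S : Multiset α) :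
    (coverings m S).card = ∑ π ∈ multisetPartitions S, (labellings m π).card := by
  have hmem : ∀ F : Fin k → Multiset α,
      F ∈ coverings m S ↔ labelType m F ∈ multisetPartitions S := by
    intro F
    rw [mem_coverings, mem_multisetPartitions, IsMultisetPartition, sum_labelType]
    simp [mem_labelType]
  rw [Finset.card_eq_sum_card_fiberwise fun F hF => (hmem F).1 hF]
  refine Finset.sum_congr rfl fun π hπ => congrArg Finset.card ?_
  ext F
  rw [Finset.mem_filter, mem_labellings, hmem]
  constructor
  · exact fun h => h.2
  · rintro rfl
    exact ⟨hπ, rfl⟩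

/-- The multiplicities of different elements of `S` in the labels are chosen independently, each as
a weighted composition. -/
theorem card_coverings_eq_prod (m : Fin k → ℕ) (S : Multiset α) :
    (coverings m S).card = ∏ a ∈ S.toFinset, (weightedCompositions m (S.count a)).card := by
  have hcount : ∀ (G : S.toFinset → Fin k → ℕ) (a : S.toFinset) (c : Fin k),
      (∑ b : S.toFinset, Multiset.replicate (G b c) (b : α)).count (a : α) = G a c := by
    intro G a c
    rw [Multiset.count_sum', Finset.sum_eq_single a]
    · simp
    · intro b _ hb
      rw [Multiset.count_replicate, if_neg fun h => hb (Subtype.ext h)]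
    · simp
  have hnotMem : ∀ (G : S.toFinset → Fin k → ℕ) (a : α) (c : Fin k), a ∉ S.toFinset →
      (∑ b : S.toFinset, Multiset.replicate (G b c) (b : α)).count a = 0 := by
    intro G a c ha
    rw [Multiset.count_sum']
    refine Finset.sum_eq_zero fun b _ => ?_
    rw [Multiset.count_replicate, if_neg]
    rintro rfl
    exact ha b.2
  have hcov : ∀ H : Fin k → Multiset α,
      H ∈ coverings m S ↔ ∀ a, ∑ c, (m c + 1) * (H c).count a = S.count a := by
    intro H
    rw [mem_coverings, Multiset.ext]
    simp only [Multiset.count_sum', Multiset.count_nsmul]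
  have hzero : ∀ H ∈ coverings m S, ∀ a ∉ S.toFinset, ∀ c, (H c).count a = 0 := by
    intro H hH a ha c
    have := (hcov H).1 hH a
    rw [Multiset.count_eq_zero_of_notMem (by simpa using ha), Finset.sum_eq_zero_iff] at this
    simpa using this c (Finset.mem_univ c)
  rw [← Finset.prod_coe_sort, ← Fintype.card_piFinset]
  refine Finset.card_nbij' (fun H a c => (H c).count (a : α))
    (fun G c => ∑ b : S.toFinset, Multiset.replicate (G b c) (b : α)) ?_ ?_ ?_ ?_
  · intro H hH
    simp only [Finset.mem_coe, Fintype.mem_piFinset, mem_weightedCompositions]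
    exact fun a => (hcov H).1 hH a
  · intro G hG
    simp only [Finset.mem_coe, Fintype.mem_piFinset, mem_weightedCompositions] at hG
    rw [Finset.mem_coe, hcov]
    intro a
    by_cases ha : a ∈ S.toFinset
    · rw [← hG ⟨a, ha⟩]
      exact Finset.sum_congr rfl fun c _ => by rw [← hcount G ⟨a, ha⟩ c]
    · rw [Multiset.count_eq_zero_of_notMem (by simpa using ha)]
      exact Finset.sum_eq_zero fun c _ => by rw [hnotMem G a c ha, mul_zero]
  · intro H hH
    ext c a
    by_cases ha : a ∈ S.toFinset
    · exact hcount (fun b c => (H c).count (b : α)) ⟨a, ha⟩ c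
    · rw [hzero H hH a ha c]
      exact hnotMem (fun b c => (H c).count (b : α)) a c ha
  · intro G _
    ext a c
    exact hcount G a c

theorem evalCycles_hPart (m : Fin k → ℕ) {n : ℕ} (lam : n.Partition) :
    evalCycles m (hPart lam) =
      ∑ π ∈ multisetPartitions (content lam), ((labellings m π).card : ℚ) := by
  rw [← Nat.cast_sum, ← card_coverings_eq_sum, card_coverings_eq_prod, hPart,
    ← map_count_content lam, Multiset.map_map, Nat.cast_prod]
  refine (map_prod (evalCycles m) _ (content lam).toFinset).trans ?_
  exact Finset.prod_congr rfl fun a _ => evalCycles_hSym m _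

theorem mTilde_map_singleton_parts (S : Multiset α) :
    (mTilde (S.map fun a => ({a} : Multiset α))).parts = S.toFinset.val.map fun a => S.count a := by
  have hinj : Function.Injective (fun a : α => ({a} : Multiset α)) :=
    fun a b e => Multiset.singleton_inj.1 e
  simp only [mTilde]
  rw [Multiset.toFinset_map, Finset.image_val_of_injOn hinj.injOn, Multiset.map_map]
  simp only [Function.comp_def, Multiset.count_map_eq_count' _ _ hinj]

/-- Equal shapes force ℓ(π) = n, so every block is a singleton. Thus the recursion for h̃ omits
exactly one multiset partition. -/
theorem filter_mTilde_parts_eq {n : ℕ} (lam : n.Partition) :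
    (multisetPartitions (content lam)).filter (fun π => (mTilde π).parts = lam.parts) =
      {(content lam).map fun a => {a}} := by
  ext π
  rw [Finset.mem_filter, Finset.mem_singleton, mem_multisetPartitions]
  constructor
  · rintro ⟨⟨h0, hs⟩, hp⟩
    have hc : Multiset.card π = n := by
      rw [← (mTilde π).parts_sum, hp, lam.parts_sum]
    have h1 := eq_map_singleton π h0 (by rw [hs, card_content, hc])
    rwa [hs] at h1
  · rintro rfl
    refine ⟨⟨by simp, Multiset.sum_map_singleton _⟩, ?_⟩
    rw [mTilde_map_singleton_parts, map_count_content]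

/-- By induction the subtracted terms cancel all of `evalCycles_hPart` except the partition into
singletons. -/
theorem evalCycles_hTilde (m : Fin k → ℕ) (n : ℕ) (lam : n.Partition) :
    evalCycles m (hTilde lam) =
      (labellings m ((content lam).map fun a => ({a} : Multiset ℕ))).card := by
  induction n using Nat.strong_induction_on with
  | _ n ih =>
    have hsum : ∑ π ∈ (multisetPartitions (content lam)).filter
        (fun π => (mTilde π).parts ≠ lam.parts), evalCycles m (hTilde (mTilde π)) =
        ∑ π ∈ (multisetPartitions (content lam)).filter
          (fun π => (mTilde π).parts ≠ lam.parts), ((labellings m π).card : ℚ) := by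
      refine Finset.sum_congr rfl fun π hπ => ?_
      rw [Finset.mem_filter, mem_multisetPartitions] at hπ
      rw [ih _ (card_lt_of_mTilde_ne lam hπ.1 hπ.2)]
      congr 1
      refine card_labellings_eq_of_mTilde m (by simp) hπ.1.1 ?_
      rw [mTilde_map_singleton_parts, map_count_content]
    rw [hTilde, map_sub, map_sum, evalCycles_hPart,
      Finset.sum_attach _ (fun π => evalCycles m (hTilde (mTilde π))), hsum,
      ← Finset.sum_filter_add_sum_filter_not _ (fun π => (mTilde π).parts = lam.parts),
      add_sub_cancel_right, filter_mTilde_parts_eq, Finset.sum_singleton]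

theorem evalCycles_hTilde_mTilde (m : Fin k → ℕ) {π : Multiset (Multiset α)} (h0 : 0 ∉ π) :
    evalCycles m (hTilde (mTilde π)) = (labellings m π).card := by
  rw [evalCycles_hTilde]
  congr 1
  refine card_labellings_eq_of_mTilde m (by simp) h0 ?_
  rw [mTilde_map_singleton_parts, map_count_content]

/-! ### Products of numbers of labellings -/

/-- Labels can be restricted cycle by cycle: an empty label discarded beforehand would have
restricted to an empty one. -/
theorem restrict_labelType (m : Fin k → ℕ) (H : Fin k → Multiset α) (T : Multiset α) :
    restrict (labelType m H) T = labelType m fun c => (H c).filter (· ∈ T) := by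
  have h1 : ∀ s : Multiset (Multiset α), restrict (s.filter (· ≠ 0)) T = restrict s T := by
    intro s
    induction s using Multiset.induction_on with
    | empty => rfl
    | cons A s ih =>
      unfold restrict at ih ⊢
      by_cases hA : A = 0
      · subst hA
        rw [Multiset.filter_cons_of_neg _ (by simp), ih, Multiset.map_cons,
          Multiset.filter_cons_of_neg (p := (· ≠ 0)) _ (by simp)]
      · rw [Multiset.filter_cons_of_pos (p := (· ≠ 0)) _ hA, Multiset.map_cons, Multiset.map_cons,
          Multiset.filter_cons, Multiset.filter_cons, ih]
  rw [labelType, h1, restrict, labelType]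
  congr 1
  rw [← Multiset.coe_mapAddMonoidHom, map_sum]
  simp

theorem mem_of_mem_label {m : Fin k → ℕ} {F : Fin k → Multiset α} {π : Multiset (Multiset α)}
    {S : Multiset α} (hπ : IsMultisetPartition π S) (hF : labelType m F = π) {c : Fin k} {a : α}
    (ha : a ∈ F c) : a ∈ S := by
  have hmem : F c ∈ π := by
    rw [← hF, mem_labelType]
    refine ⟨?_, c, rfl⟩
    intro h
    simp [h] at ha
  rw [← hπ.2]
  exact Multiset.mem_of_le (Multiset.le_sum_of_mem hmem) ha

theorem filter_mem_add_filter_mem {S T A : Multiset α} (hST : Disjoint S T)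
    (hA : ∀ a ∈ A, a ∈ S + T) : A.filter (· ∈ S) + A.filter (· ∈ T) = A := by
  conv_rhs => rw [← Multiset.filter_add_not (· ∈ S) A]
  congr 1
  refine Multiset.filter_congr fun a ha => ⟨fun hT hS => Multiset.disjoint_left.1 hST hS hT, ?_⟩
  exact (Multiset.mem_add.1 (hA a ha)).resolve_left

theorem card_labellings_mul (m : Fin k → ℕ) {S T : Multiset α} (hST : Disjoint S T)
    {π τ : Multiset (Multiset α)} (hπ : IsMultisetPartition π S) (hτ : IsMultisetPartition τ T) :
    (labellings m π).card * (labellings m τ).card =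
      ∑ θ ∈ sharp S T π τ, (labellings m θ).card := by
  have hdisj : ∀ a ∈ S, a ∉ T := fun a => Multiset.disjoint_left.1 hST
  have hleft : ∀ F G : Fin k → Multiset α, labelType m F = π → labelType m G = τ → ∀ c,
      (F c + G c).filter (· ∈ S) = F c := by
    intro F G hF hG c
    rw [Multiset.filter_add, Multiset.filter_eq_self.2 fun a ha => mem_of_mem_label hπ hF ha,
      Multiset.filter_eq_nil.2 fun a ha h => hdisj a h (mem_of_mem_label hτ hG ha), add_zero]
  have hright : ∀ F G : Fin k → Multiset α, labelType m F = π → labelType m G = τ → ∀ c,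
      (F c + G c).filter (· ∈ T) = G c := by
    intro F G hF hG c
    rw [Multiset.filter_add, Multiset.filter_eq_nil.2 fun a ha =>
      hdisj a (mem_of_mem_label hπ hF ha),
      Multiset.filter_eq_self.2 fun a ha => mem_of_mem_label hτ hG ha, zero_add]
  have hsharp : ∀ p ∈ labellings m π ×ˢ labellings m τ,
      labelType m (fun c => p.1 c + p.2 c) ∈ sharp S T π τ := by
    rintro ⟨F, G⟩ hp
    rw [Finset.mem_product, mem_labellings, mem_labellings] at hp
    obtain ⟨hF, hG⟩ := hp
    simp only at hF hG
    rw [sharp, Finset.mem_filter, mem_multisetPartitions]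
    refine ⟨⟨by simp [mem_labelType], ?_⟩, ?_, ?_⟩
    · rw [sum_labelType]
      simp only [smul_add, Finset.sum_add_distrib]
      rw [← sum_labelType, ← sum_labelType, hF, hG, hπ.2, hτ.2]
    · rw [restrict_labelType, ← hF]
      exact congrArg _ (funext fun c => hleft F G hF hG c)
    · rw [restrict_labelType, ← hG]
      exact congrArg _ (funext fun c => hright F G hF hG c)
  -- The pairs are sorted by the type θ of the merged labelling; each fiber is then matched with the
  -- labellings of type θ.
  rw [← Finset.card_product, Finset.card_eq_sum_card_fiberwise hsharp]
  refine Finset.sum_congr rfl fun θ hθ => ?_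
  rw [sharp, Finset.mem_filter, mem_multisetPartitions] at hθ
  obtain ⟨hθ, hθS, hθT⟩ := hθ
  refine Finset.card_nbij' (fun p c => p.1 c + p.2 c)
    (fun H => (fun c => (H c).filter (· ∈ S), fun c => (H c).filter (· ∈ T))) ?_ ?_ ?_ ?_
  · intro p hp
    rw [Finset.mem_coe, Finset.mem_filter] at hp
    exact mem_labellings.2 hp.2
  · intro H hH
    rw [Finset.mem_coe, mem_labellings] at hH
    rw [Finset.mem_coe, Finset.mem_filter, Finset.mem_product, mem_labellings, mem_labellings,
      ← restrict_labelType, ← restrict_labelType, hH]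
    refine ⟨⟨hθS, hθT⟩, ?_⟩
    rw [← hH]
    exact congrArg _ (funext fun c =>
      filter_mem_add_filter_mem hST fun a ha => mem_of_mem_label hθ hH ha)
  · rintro ⟨F, G⟩ hp
    rw [Finset.mem_coe, Finset.mem_filter, Finset.mem_product, mem_labellings,
      mem_labellings] at hp
    exact Prod.ext (funext fun c => hleft F G hp.1.1 hp.1.2 c)
      (funext fun c => hright F G hp.1.1 hp.1.2 c)
  · intro H hH
    rw [Finset.mem_coe, mem_labellings] at hH
    exact funext fun c => filter_mem_add_filter_mem hST fun a ha => mem_of_mem_label hθ hH ha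

theorem card_restrict (θ : Multiset (Multiset α)) (T : Multiset α) :
    Multiset.card (restrict θ T) =
      Multiset.card (θ.filter fun A => A.filter (· ∈ T) ≠ 0) := by
  rw [restrict, Multiset.filter_map, Multiset.card_map]
  rfl

/-- Each block of θ is nonempty, so it meets S or T and survives in at least one restriction. Hence
`n - ℓ(θ)` is a genuine difference in the Kronecker formula. -/
theorem card_le_of_mem_sharp {S T : Multiset α} {π τ θ : Multiset (Multiset α)}
    (hθ : θ ∈ sharp S T π τ) : Multiset.card θ ≤ Multiset.card π + Multiset.card τ := by
  rw [sharp, Finset.mem_filter, mem_multisetPartitions] at hθ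
  obtain ⟨⟨h0, hs⟩, rfl, rfl⟩ := hθ
  -- Inclusion–exclusion: blocks meeting S or T, plus blocks meeting both.
  rw [card_restrict, card_restrict, ← Multiset.card_add, Multiset.filter_add_filter,
    Multiset.card_add]
  refine le_trans (le_of_eq ?_) (Nat.le_add_right _ _)
  rw [Multiset.filter_eq_self.2]
  intro A hA
  obtain ⟨a, ha⟩ := Multiset.exists_mem_of_ne_zero (s := A) (by rintro rfl; exact h0 hA)
  have haS : a ∈ S + T := hs ▸ Multiset.mem_of_le (Multiset.le_sum_of_mem hA) ha
  refine (Multiset.mem_add.1 haS).imp (fun h h' => ?_) (fun h h' => ?_) <;>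
  · have := Multiset.mem_filter.2 ⟨ha, h⟩
    rw [h'] at this
    exact Multiset.notMem_zero _ this

/-! ### The Kronecker product -/

/-- The factor z in the Kronecker product together with the one in `charValue` supplies one z for
each argument. -/
theorem charValue_kronecker (m : Fin k → ℕ) (f g : SymFun) :
    charValue m (kronecker f g) = charValue m f * charValue m g := by
  have h : ∀ e, (kronecker f g).coeff e = f.coeff e * g.coeff e * expZee e := by
    intro e
    rw [kronecker, coeff_sum]
    simp only [coeff_monomial, zee_map_succ]
    rw [Finset.sum_ite_eq']
    split_ifs with he
    · rfl
    · rw [notMem_support_iff.1 he, zero_mul, zero_mul]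
  rw [charValue, charValue, charValue, h]
  ring

theorem charValue_sum {β : Type*} (m : Fin k → ℕ) (s : Finset β) (f : β → SymFun) :
    charValue m (∑ b ∈ s, f b) = ∑ b ∈ s, charValue m (f b) := by
  simp only [charValue, coeff_sum, Finset.mul_sum]

theorem ext_charValue {f g : SymFun}
    (h : ∀ (k : ℕ) (m : Fin k → ℕ), charValue m f = charValue m g) : f = g := by
  ext e
  obtain ⟨k, m, rfl⟩ := exists_cycleExponent_eq e
  have := expZee_pos (cycleExponent m)
  exact mul_left_cancel₀ (by positivity) (h k m)

end CharBasis

open CharBasis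
theorem mainTheorem8 {α : Type*} [DecidableEq α] (S T : Multiset α) (hST : Disjoint S T)
    (π τ : Multiset (Multiset α))
    (hπ : IsMultisetPartition π S) (hτ : IsMultisetPartition τ T) :
    hTilde (mTilde π) * hTilde (mTilde τ) = ∑ θ ∈ sharp S T π τ, hTilde (mTilde θ) ∧
    ∀ n : ℕ, Multiset.card π + Multiset.card τ ≤ n →
      kronecker (hSym (n - Multiset.card π) * hPart (mTilde π))
          (hSym (n - Multiset.card τ) * hPart (mTilde τ)) =
        ∑ θ ∈ sharp S T π τ, hSym (n - Multiset.card θ) * hPart (mTilde θ) := by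
  have hzero : ∀ θ ∈ sharp S T π τ, 0 ∉ θ := fun θ hθ =>
    (mem_multisetPartitions.1 (Finset.mem_filter.1 hθ).1).1
  constructor
  · refine ext_evalCycles fun k m => ?_
    rw [map_mul, map_sum, evalCycles_hTilde_mTilde m hπ.1, evalCycles_hTilde_mTilde m hτ.1,
      ← Nat.cast_mul, card_labellings_mul m hST hπ hτ, Nat.cast_sum]
    exact Finset.sum_congr rfl fun θ hθ => (evalCycles_hTilde_mTilde m (hzero θ hθ)).symm
  · intro n hn
    refine ext_charValue fun k m => ?_
    rw [charValue_kronecker, charValue_sum, charValue_hSym_mul_hPart m hπ.1 (by omega),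
      charValue_hSym_mul_hPart m hτ.1 (by omega),
      Finset.sum_congr rfl fun θ hθ => charValue_hSym_mul_hPart m (hzero θ hθ)
        ((card_le_of_mem_sharp hθ).trans hn)]
    -- If the total cycle length differs from `n`, all values vanish.
    split_ifs
    · rw [← Nat.cast_mul, card_labellings_mul m hST hπ hτ, Nat.cast_sum]
    · simp
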